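/- **Setting.** Let $\mathbf\Sigma_\omega=(\Sigma,\mathbb M,\mathbb O,\omega)$ be an oriented compact connected surface with a non-empty finite set $\mathbb M$ of marked points meeting every boundary component, a finite set $\mathbb O\subseteq\Sigma\setminus(\partial\Sigma\cup\mathbb M)$ of orbifold points, and the weight function $\omega:\mathbb O\to\{1,4\}$ constant equal to $4$. Assume that either $\mathbb M\subseteq\partial\Sigma$, or $\partial\Sigma=\varnothing$ and $|\mathbb M|=1$, and that $\mathbf\Sigma$ is neither a once-punctured closed sphere with $|\mathbb O|<4$, nor an unpunctured disc with $|\mathbb M|=|\mathbb O|=1$, nor an unpunctured disc with $|\mathbb M|\le 3$ and $\mathbb O=\varnothing$. Let $\tau$ be a triangulation of $\mathbf\Sigma$: a set of arcs that cut $\Sigma$ into finitely many triangles, where each non-pending arc joins marked points, each pending arc joins a marked point to an orbifold point, and each orbifold point is the endpoint of exactly one pending arc. (Cutting a triangle that contains orbifold points open along its pending arcs gives a triangle in which each pending arc is one side, folded at its midpoint, the orbifold point. Thus $\Sigma$ is obtained from finitely many positively oriented triangles by gluing some sides in pairs with reversed direction, folding some sides at their midpoints, and leaving the other sides as boundary segments;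 the vertices are the marked points and the midpoints of the folded sides are the orbifold points.) Let $\overline Q(\tau)$ be the quiver whose vertices are the arcs of $\tau$, with one arrow $i\to j$ for each triangle and each pair of arcs $i,j$ that are sides of it such that $j$ succeeds $i$ with respect to the orientation of $\Sigma$. Let $\widehat Q(\tau)$ be $\overline Q(\tau)$ with one additional (special) loop $s$ at each pending arc. Let $\delta=\operatorname{lcm}\{\delta_k\mid k\in\tau\}$ with $\delta_k=2$ for pending and $\delta_k=1$ for non-pending arcs $k$. Let $L/F$ be a cyclic Galois extension of fields of degree $\delta$ such that $F$ contains a primitive $\delta$-th root of unity $\zeta$, let $\theta$ generate $\operatorname{Gal}(L/F)$, and let $0\ne u\in L$ with $\theta(u)=\zeta u$. (If $\mathbb O\neq\varnothing$ then $\delta=2$, $\operatorname{char}F\ne2$ and $\theta(u)=-u$; if $\mathbb O=\varnothing$ then $L=F$ and there are no special loops.) Then $u^2\in F$. Let $F_{\boldsymbol\sigma(\tau)}\widehat Q(\tau)$ be the semilinear path algebra over $K:=F$ in which every arrow carries the trivial automorphism of $F$, and let $I(\tau)$ be its two-sided ideal generated by the set $Z(\tau)$ of all products of two consecutive arrows in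 one triangle of $\tau$ all of whose three sides are arcs, together with the special relations $s^2-u^2e_k$ for the special loops $s$ at the pending arcs $k$. **Definitions.** For a finite cyclic Galois extension $K/F$, a finite quiver $Q$ and $\boldsymbol\sigma:Q_1\to\operatorname{Gal}(K/F)$, the semilinear path algebra $K_{\boldsymbol\sigma}Q$ has the paths of $Q$ as a left $K$-basis, with $a\lambda=\sigma_a(\lambda)a$ for arrows $a$ and $\lambda\in K$. A quotient $K_{\boldsymbol\sigma}Q/I$ is a *semilinear clannish algebra* (a *clannish $F$-algebra* if $K=F$ and all $\sigma_a$ are trivial) if there are a set $\mathbb S$ of special loops (the other arrows being called ordinary), a set $Z$ of paths, and elements $\beta_s,\gamma_s\in K$ $(s\in\mathbb S)$ such that * (Q) every vertex is the head of at most two arrows and the tail of at most two arrows; * (Z) every $p\in Z$ has length at least two; for every ordinary arrow $a$ there is at most one arrow $b$ with $ba$ a path not in $Z$, and at most one arrow $b$ with $ab$ a path not in $Z$; no $p\in Z$ starts or ends with a special loop $s$ or contains $s^2$; * (S) $I$ is generated by $Z$ and the elements $s^2-\beta_s s+\gamma_s e_i$, where $s\in\mathbb S$ is a loop at $i$. Put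 $q_s(x)=x^2-\beta_sx+\gamma_s\in K[x;\sigma_s]$. The algebra, so presented, is *normally-bound* if $K[x;\sigma_s]q_s=q_sK[x;\sigma_s]$ for all $s$, *non-singular* if $\gamma_s\neq0$ for all $s$, and *of semisimple type* if $K[x;\sigma_s]/\langle q_s\rangle$ is a semisimple ring for all $s$. **Proposition.** For every such $\mathbf\Sigma_\omega$ with $\omega\equiv4$ and every triangulation $\tau$, the algebra $F_{\boldsymbol\sigma(\tau)}\widehat Q(\tau)/I(\tau)$ is a clannish $F$-algebra, with the loops added at the pending arcs as special loops, $Z(\tau)$ as the set of zero-relations, and $q_s(x)=x^2-u^2$ for all special loops $s$. It is normally-bound, non-singular and of semisimple type. -/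

import Mathlib

open scoped Manifold Topology

noncomputable section

/-! ## Finite quivers, paths and semilinear path algebras -/

/-- A finite quiver: vertices `V`, arrows `E`, and head and tail maps. -/
structure FinQuiver where
  V : Type
  E : Type
  [fintypeV : Fintype V]
  [fintypeE : Fintype E]
  head : E → V
  tail : E → V

attribute [instance] FinQuiver.fintypeV FinQuiver.fintypeE

namespace FinQuiver

/-- `Q.IsWalk i [a_n, ..., a_1] j` says that `a_n ⋯ a_1` is a path with head `i` and tail `j`:
arrows are composed from right to left, so `t(a_{r+1}) = h(a_r)`. -/
def IsWalk (Q : FinQuiver) : Q.V → List Q.E → Q.V → Prop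
  | i, [], j => i = j
  | i, a :: w, j => Q.head a = i ∧ IsWalk Q (Q.tail a) w j

/-- A path `a_n ⋯ a_1` of a quiver; the empty word gives the trivial paths. -/
@[ext]
structure Path (Q : FinQuiver) where
  head : Q.V
  tail : Q.V
  word : List Q.E
  isWalk : Q.IsWalk head word tail

theorem IsWalk.append {Q : FinQuiver} {j k : Q.V} {w' : List Q.E} (h' : Q.IsWalk j w' k) :
    ∀ {w : List Q.E} {i : Q.V}, Q.IsWalk i w j → Q.IsWalk i (w ++ w') k
  | [], _, h => by
      have h0 : _ = j := h
      subst h0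
      exact h'
  | _ :: _, _, h => ⟨h.1, IsWalk.append h' h.2⟩

namespace Path

variable {Q : FinQuiver}

/-- The trivial path at `i`. -/
def nil (i : Q.V) : Q.Path := ⟨i, i, [], rfl⟩

/-- An arrow as a path of length one. -/
def arrow (a : Q.E) : Q.Path := ⟨Q.head a, Q.tail a, [a], rfl, rfl⟩

/-- The composite path `p q` (first `q`, then `p`), when `t(p) = h(q)`. -/
def comp (p q : Q.Path) (h : p.tail = q.head) : Q.Path :=
  ⟨p.head, q.tail, p.word ++ q.word, IsWalk.append (h ▸ q.isWalk) p.isWalk⟩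

/-- The path `b a` of length two, when `t(b) = h(a)`. -/
def two (b a : Q.E) (h : Q.tail b = Q.head a) : Q.Path := comp (arrow b) (arrow a) h

end Path

end FinQuiver

section SemilinearPathAlgebra

variable {F K : Type*} [Field F] [Field K] [Algebra F K] {Q : FinQuiver}

/-- The automorphism `σ_p = σ_{a_n} ∘ ⋯ ∘ σ_{a_1}` attached to a path `p = a_n ⋯ a_1`. -/
def pathAut (σ : Q.E → (K ≃ₐ[F] K)) (p : Q.Path) : K ≃ₐ[F] K := (p.word.map σ).prod

theorem pathAut_nil (σ : Q.E → (K ≃ₐ[F] K)) (i : Q.V) : pathAut σ (.nil i) = 1 := rfl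

theorem pathAut_comp (σ : Q.E → (K ≃ₐ[F] K)) (p q : Q.Path) (h : p.tail = q.head) :
    pathAut σ (p.comp q h) = pathAut σ p * pathAut σ q := by
  simp [pathAut, FinQuiver.Path.comp]

/-- The semilinear path algebra `K_σ Q`, in its normal form: the elements of the tensor ring of the
bimodule `⨁_a K^{σ_a} ⊗_K K` over `∏_i K` are uniquely the finite sums `∑ λ_p p` over the paths `p`
with coefficients on the left, multiplied by means of `a λ = σ_a(λ) a`. -/
def SemilinearPathAlgebra (_σ : Q.E → (K ≃ₐ[F] K)) : Type _ := Q.Path →₀ K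

namespace SemilinearPathAlgebra

variable (σ : Q.E → (K ≃ₐ[F] K))

instance : AddCommGroup (SemilinearPathAlgebra σ) := inferInstanceAs (AddCommGroup (Q.Path →₀ K))

instance : Module F (SemilinearPathAlgebra σ) := inferInstanceAs (Module F (Q.Path →₀ K))

/-- The element `c p` for a scalar `c` and a path `p`. -/
def term (p : Q.Path) (c : K) : SemilinearPathAlgebra σ := (Finsupp.single p c : Q.Path →₀ K)

open Classical in
/-- `(a p) (b q) = a σ_p(b) (p q)` if `p q` is a path, and `0` otherwise. -/
def termMul (p : Q.Path) (a : K) (q : Q.Path) (b : K) : SemilinearPathAlgebra σ :=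
  if h : p.tail = q.head then term σ (p.comp q h) (a * pathAut σ p b) else 0

instance : Mul (SemilinearPathAlgebra σ) where
  mul x y := Finsupp.sum (M := K) x fun p a => Finsupp.sum (M := K) y fun q b => termMul σ p a q b

instance : One (SemilinearPathAlgebra σ) where
  one := ∑ i : Q.V, term σ (.nil i) 1

theorem term_zero (p : Q.Path) : term σ p 0 = 0 := Finsupp.single_zero p

theorem term_add (p : Q.Path) (a b : K) : term σ p (a + b) = term σ p a + term σ p b :=
  Finsupp.single_add p a b

theorem termMul_zero_left (p q : Q.Path) (b : K) : termMul σ p 0 q b = 0 := by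
  unfold termMul; split_ifs <;> simp [term_zero]

theorem termMul_zero_right (p q : Q.Path) (a : K) : termMul σ p a q 0 = 0 := by
  unfold termMul; split_ifs <;> simp [term_zero]

theorem termMul_add_left (p q : Q.Path) (a a' b : K) :
    termMul σ p (a + a') q b = termMul σ p a q b + termMul σ p a' q b := by
  unfold termMul; split_ifs <;> simp [← term_add, add_mul]

theorem termMul_add_right (p q : Q.Path) (a b b' : K) :
    termMul σ p a q (b + b') = termMul σ p a q b + termMul σ p a q b' := by
  unfold termMul; split_ifs <;> simp [← term_add, mul_add]

protected theorem mul_def (x y : SemilinearPathAlgebra σ) : x * y =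
    Finsupp.sum (M := K) x fun p a => Finsupp.sum (M := K) y fun q b => termMul σ p a q b := rfl

protected theorem zero_mul' (y : SemilinearPathAlgebra σ) : 0 * y = 0 := by
  rw [SemilinearPathAlgebra.mul_def]
  exact Finsupp.sum_zero_index

protected theorem mul_zero' (x : SemilinearPathAlgebra σ) : x * 0 = 0 := by
  rw [SemilinearPathAlgebra.mul_def]
  exact Finset.sum_eq_zero fun p _ => Finsupp.sum_zero_index

protected theorem add_mul' (x x' y : SemilinearPathAlgebra σ) :
    (x + x') * y = x * y + x' * y := by
  simp only [SemilinearPathAlgebra.mul_def]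
  refine Finsupp.sum_add_index' (fun p => ?_) (fun p a a' => ?_)
  · exact Finset.sum_eq_zero fun q _ => termMul_zero_left σ p q _
  · simp only [termMul_add_left]
    exact Finsupp.sum_add

protected theorem mul_add' (x y y' : SemilinearPathAlgebra σ) :
    x * (y + y') = x * y + x * y' := by
  simp only [SemilinearPathAlgebra.mul_def]
  refine Eq.trans ?_ Finsupp.sum_add
  refine Finset.sum_congr rfl fun p _ => ?_
  exact Finsupp.sum_add_index' (fun q => termMul_zero_right σ p q _)
    (fun q b b' => termMul_add_right σ p q _ b b')

theorem term_mul_term (p q : Q.Path) (a b : K) : term σ p a * term σ q b = termMul σ p a q b := by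
  rw [SemilinearPathAlgebra.mul_def]
  have h := Finsupp.sum_single_index (a := p) (b := a)
    (h := fun p a => Finsupp.sum (M := K) (term σ q b) fun q b => termMul σ p a q b)
    (Finset.sum_eq_zero fun q _ => termMul_zero_left σ p q _)
  refine h.trans ?_
  exact Finsupp.sum_single_index (termMul_zero_right σ p q a)

theorem induction_term {P : SemilinearPathAlgebra σ → Prop} (x : SemilinearPathAlgebra σ)
    (zero : P 0) (add : ∀ x y, P x → P y → P (x + y)) (term : ∀ p a, P (term σ p a)) : P x :=
  Finsupp.induction_linear x zero add term

theorem term_mul_assoc (p q r : Q.Path) (a b c : K) :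
    term σ p a * term σ q b * term σ r c = term σ p a * (term σ q b * term σ r c) := by
  rw [term_mul_term, term_mul_term]
  by_cases hpq : p.tail = q.head <;> by_cases hqr : q.tail = r.head
  · have h1 : (p.comp q hpq).tail = r.head := hqr
    have h2 : p.tail = (q.comp r hqr).head := hpq
    have h3 : (p.comp q hpq).comp r h1 = p.comp (q.comp r hqr) h2 := by
      ext1 <;> simp [FinQuiver.Path.comp]
    rw [termMul, dif_pos hpq, termMul, dif_pos hqr, term_mul_term, term_mul_term, termMul,
      dif_pos h1, termMul, dif_pos h2, h3, pathAut_comp]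
    simp [mul_assoc]
  · have h1 : ¬ (p.comp q hpq).tail = r.head := hqr
    rw [termMul, dif_pos hpq, termMul, dif_neg hqr, term_mul_term, termMul, dif_neg h1,
      SemilinearPathAlgebra.mul_zero']
  · have h2 : ¬ p.tail = (q.comp r hqr).head := hpq
    rw [termMul, dif_neg hpq, termMul, dif_pos hqr, term_mul_term, termMul, dif_neg h2,
      SemilinearPathAlgebra.zero_mul']
  · rw [termMul, dif_neg hpq, termMul, dif_neg hqr, SemilinearPathAlgebra.mul_zero',
      SemilinearPathAlgebra.zero_mul']

protected theorem mul_assoc' (x y z : SemilinearPathAlgebra σ) : x * y * z = x * (y * z) := by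
  induction x using induction_term with
  | zero => simp only [SemilinearPathAlgebra.zero_mul']
  | add x x' hx hx' => simp only [SemilinearPathAlgebra.add_mul', hx, hx']
  | term p a =>
    induction y using induction_term with
    | zero => simp only [SemilinearPathAlgebra.zero_mul', SemilinearPathAlgebra.mul_zero']
    | add y y' hy hy' =>
      simp only [SemilinearPathAlgebra.add_mul', SemilinearPathAlgebra.mul_add', hy, hy']
    | term q b =>
      induction z using induction_term with
      | zero => simp only [SemilinearPathAlgebra.mul_zero']
      | add z z' hz hz' => simp only [SemilinearPathAlgebra.mul_add', hz, hz']
      | term r c => exact term_mul_assoc σ p q r a b c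

protected theorem one_mul_term (p : Q.Path) (a : K) : 1 * term σ p a = term σ p a := by
  have h : (1 : SemilinearPathAlgebra σ) * term σ p a =
      ∑ i : Q.V, term σ (.nil i) 1 * term σ p a :=
    map_sum (⟨⟨fun x => x * term σ p a, SemilinearPathAlgebra.zero_mul' σ _⟩,
      fun x y => SemilinearPathAlgebra.add_mul' σ x y _⟩ :
        SemilinearPathAlgebra σ →+ SemilinearPathAlgebra σ) _ _
  rw [h, Finset.sum_eq_single p.head]
  · have h1 : (FinQuiver.Path.nil p.head).tail = p.head := rfl
    rw [term_mul_term, termMul, dif_pos h1, pathAut_nil]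
    simp [FinQuiver.Path.comp, FinQuiver.Path.nil]
  · intro i _ hi
    rw [term_mul_term, termMul, dif_neg (show ¬ (FinQuiver.Path.nil i).tail = p.head from hi)]
  · intro hp
    exact absurd (Finset.mem_univ _) hp

protected theorem term_mul_one (p : Q.Path) (a : K) : term σ p a * 1 = term σ p a := by
  have h : term σ p a * (1 : SemilinearPathAlgebra σ) =
      ∑ i : Q.V, term σ p a * term σ (.nil i) 1 :=
    map_sum (⟨⟨fun x => term σ p a * x, SemilinearPathAlgebra.mul_zero' σ _⟩,
      fun x y => SemilinearPathAlgebra.mul_add' σ _ x y⟩ :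
        SemilinearPathAlgebra σ →+ SemilinearPathAlgebra σ) _ _
  rw [h, Finset.sum_eq_single p.tail]
  · have h1 : p.tail = (FinQuiver.Path.nil p.tail).head := rfl
    rw [term_mul_term, termMul, dif_pos h1]
    simp [FinQuiver.Path.comp, FinQuiver.Path.nil]
  · intro i _ hi
    rw [term_mul_term, termMul,
      dif_neg (show ¬ p.tail = (FinQuiver.Path.nil i).head from fun h => hi h.symm)]
  · intro hp
    exact absurd (Finset.mem_univ _) hp

instance : Ring (SemilinearPathAlgebra σ) where
  __ := (inferInstance : AddCommGroup (SemilinearPathAlgebra σ))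
  zero_mul := SemilinearPathAlgebra.zero_mul' σ
  mul_zero := SemilinearPathAlgebra.mul_zero' σ
  left_distrib := SemilinearPathAlgebra.mul_add' σ
  right_distrib := SemilinearPathAlgebra.add_mul' σ
  mul_assoc := SemilinearPathAlgebra.mul_assoc' σ
  one_mul x := by
    induction x using induction_term with
    | zero => exact SemilinearPathAlgebra.mul_zero' σ 1
    | add x y hx hy => rw [SemilinearPathAlgebra.mul_add', hx, hy]
    | term p a => exact SemilinearPathAlgebra.one_mul_term σ p a
  mul_one x := by
    induction x using induction_term with
    | zero => exact SemilinearPathAlgebra.zero_mul' σ 1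
    | add x y hx hy => rw [SemilinearPathAlgebra.add_mul', hx, hy]
    | term p a => exact SemilinearPathAlgebra.term_mul_one σ p a

theorem smul_term (r : F) (p : Q.Path) (a : K) : r • term σ p a = term σ p (r • a) :=
  Finsupp.smul_single r p a

/-- `F` is central in `K_σ Q`, since every `σ_a` fixes `F`. -/
instance : Algebra F (SemilinearPathAlgebra σ) := Algebra.ofModule
  (by
    intro r x y
    induction x using induction_term with
    | zero => simp
    | add x x' hx hx' => simp only [smul_add, add_mul, hx, hx']
    | term p a =>
      induction y using induction_term with
      | zero => simp
      | add y y' hy hy' => simp only [smul_add, mul_add, hy, hy']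
      | term q b =>
        rw [smul_term, term_mul_term, term_mul_term, termMul, termMul]
        split_ifs <;> simp [smul_term])
  (by
    intro r x y
    induction x using induction_term with
    | zero => simp
    | add x x' hx hx' => simp only [smul_add, add_mul, hx, hx']
    | term p a =>
      induction y using induction_term with
      | zero => simp
      | add y y' hy hy' => simp only [smul_add, mul_add, hy, hy']
      | term q b =>
        rw [smul_term, term_mul_term, term_mul_term, termMul, termMul]
        split_ifs <;> simp [smul_term])

/-- A path as an element of `K_σ Q`. -/
def ofPath (p : Q.Path) : SemilinearPathAlgebra σ := term σ p 1

/-- An arrow as an element of `K_σ Q`. -/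
def ofArrow (a : Q.E) : SemilinearPathAlgebra σ := ofPath σ (.arrow a)

/-- The element `c e_i` of `K_σ Q`, for `c ∈ K`. -/
def scalarAt (i : Q.V) (c : K) : SemilinearPathAlgebra σ := term σ (.nil i) c

end SemilinearPathAlgebra

end SemilinearPathAlgebra

/-! ## Quadratics in skew polynomial rings -/

section SkewQuadratics

variable {F K : Type*} [Field F] [Field K] [Algebra F K]

/-- The field `K`, on which the monoid `ℕ` acts through the powers of `σ`. -/
def TwistedField (_σ : K ≃ₐ[F] K) : Type _ := K

instance (σ : K ≃ₐ[F] K) : Field (TwistedField σ) := inferInstanceAs (Field K)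

instance (σ : K ≃ₐ[F] K) : MulSemiringAction (Multiplicative ℕ) (TwistedField σ) :=
  MulSemiringAction.compHom K (powersHom (K ≃ₐ[F] K) σ)

/-- The skew polynomial ring `K[x;σ]`, in which `x λ = σ(λ) x`. -/
abbrev SkewPolyRing (σ : K ≃ₐ[F] K) : Type _ := SkewPolynomial (TwistedField σ)

/-- The monic quadratic `x² - β x + γ` in `K[x;σ]`. -/
def skewQuadratic (σ : K ≃ₐ[F] K) (β γ : K) : SkewPolyRing σ :=
  SkewPolynomial.monomial 2 (1 : TwistedField σ) - SkewPolynomial.monomial 1 (show TwistedField σ from β)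
    + SkewPolynomial.monomial 0 (show TwistedField σ from γ)

/-- `q` is normal: the left and the right ideal generated by `q` coincide. -/
def IsNormalElement {R : Type*} [Ring R] (q : R) : Prop :=
  {x : R | ∃ r, x = r * q} = {x : R | ∃ r, x = q * r}

/-- The quotient of `R` by the two-sided ideal generated by `q` is a semisimple ring. -/
def IsOfSemisimpleType {R : Type*} [Ring R] (q : R) : Prop :=
  IsSemisimpleRing (TwoSidedIdeal.span {q}).ringCon.Quotient

end SkewQuadratics

/-! ## Semilinear clannish algebras -/

/-- A presentation of `K_σ Q / I` as a semilinear clannish algebra: `K/F` is a finite cyclic Galois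
extension, and `I` is generated by a set `Z` of zero-relations and by one special relation
`s² - β_s s + γ_s e_i` for every special loop `s` at `i`, subject to the conditions below. -/
structure SemilinearClannishPresentation {F K : Type*} [Field F] [Field K] [Algebra F K]
    {Q : FinQuiver} (σ : Q.E → (K ≃ₐ[F] K)) (I : TwoSidedIdeal (SemilinearPathAlgebra σ)) where
  finiteDimensional : FiniteDimensional F K
  isGalois : IsGalois F K
  isCyclic : IsCyclic (K ≃ₐ[F] K)
  /-- the special loops; all other arrows are called ordinary -/
  special : Set Q.E
  head_eq_tail : ∀ s ∈ special, Q.head s = Q.tail s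
  encard_head_le : ∀ i, {b | Q.head b = i}.encard ≤ 2
  encard_tail_le : ∀ i, {c | Q.tail c = i}.encard ≤ 2
  /-- the zero-relations -/
  Z : Set Q.Path
  two_le_length : ∀ p ∈ Z, 2 ≤ p.word.length
  subsingleton_left : ∀ a ∉ special,
    {b | ∃ h : Q.tail b = Q.head a, FinQuiver.Path.two b a h ∉ Z}.Subsingleton
  subsingleton_right : ∀ a ∉ special,
    {b | ∃ h : Q.tail a = Q.head b, FinQuiver.Path.two a b h ∉ Z}.Subsingleton
  not_starts : ∀ p ∈ Z, ∀ s ∈ special, p.word.getLast? ≠ some s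
  not_ends : ∀ p ∈ Z, ∀ s ∈ special, p.word.head? ≠ some s
  not_square : ∀ p ∈ Z, ∀ s ∈ special, ¬ [s, s] <:+: p.word
  β : special → K
  γ : special → K
  ideal_eq : I = TwoSidedIdeal.span
    (SemilinearPathAlgebra.ofPath σ '' Z ∪
      Set.range fun s : special =>
        SemilinearPathAlgebra.ofArrow σ s * SemilinearPathAlgebra.ofArrow σ s
          - SemilinearPathAlgebra.scalarAt σ (Q.head s) (β s) * SemilinearPathAlgebra.ofArrow σ s
          + SemilinearPathAlgebra.scalarAt σ (Q.head s) (γ s))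

namespace SemilinearClannishPresentation

variable {F K : Type*} [Field F] [Field K] [Algebra F K] {Q : FinQuiver}
  {σ : Q.E → (K ≃ₐ[F] K)} {I : TwoSidedIdeal (SemilinearPathAlgebra σ)}

/-- The quadratic `q_s(x) = x² - β_s x + γ_s` in `K[x;σ_s]` of a special loop `s`. -/
def quadratic (P : SemilinearClannishPresentation σ I) (s : P.special) : SkewPolyRing (σ s) :=
  skewQuadratic (σ s) (P.β s) (P.γ s)

def IsNormallyBound (P : SemilinearClannishPresentation σ I) : Prop :=
  ∀ s, IsNormalElement (P.quadratic s)

def IsNonSingular (P : SemilinearClannishPresentation σ I) : Prop :=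
  ∀ s, SkewPolynomial.coeff (P.quadratic s) 0 ≠ 0

def IsSemisimpleType (P : SemilinearClannishPresentation σ I) : Prop :=
  ∀ s, IsOfSemisimpleType (P.quadratic s)

end SemilinearClannishPresentation

/-! ## Field data -/

/-- A degree-`d` datum `L/F`: a cyclic Galois extension of degree `d`, where `F` contains a primitive
`d`-th root of unity `ζ`, with a generator `θ` of the Galois group and a non-zero `u` such that
`θ(u) = ζ u`. For `d = 1` this is just a field `F` (and a choice of `u ∈ F`); for `d = 2` it is an
extension of degree two in characteristic different from two, and `θ(u) = -u`. -/
structure DegreeDatum (d : ℕ) (F L : Type*) [Field F] [Field L] [Algebra F L] where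
  finrank_eq : Module.finrank F L = d
  isGalois : IsGalois F L
  ζ : F
  isPrimitiveRoot : IsPrimitiveRoot ζ d
  θ : L ≃ₐ[F] L
  generates : ∀ g : L ≃ₐ[F] L, g ∈ Subgroup.zpowers θ
  u : L
  u_ne_zero : u ≠ 0
  θ_u : θ u = algebraMap F L ζ * u

namespace DegreeDatum

variable {d : ℕ} {F L : Type*} [Field F] [Field L] [Algebra F L]

theorem exists_sq (D : DegreeDatum d F L) (hd : d ∣ 2) : ∃ c : F, algebraMap F L c = D.u ^ 2 := by
  have hpos : 0 < Module.finrank F L := by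
    rw [D.finrank_eq]; exact Nat.pos_of_dvd_of_pos hd two_pos
  have : FiniteDimensional F L := Module.finite_of_finrank_pos hpos
  have := D.isGalois
  have hζ : D.ζ ^ 2 = 1 := (D.isPrimitiveRoot.pow_eq_one_iff_dvd 2).2 hd
  have hu : D.θ (D.u ^ 2) = D.u ^ 2 := by
    rw [map_pow, D.θ_u, mul_pow, ← map_pow, hζ, map_one, one_mul]
  have hst : D.θ ∈ MulAction.stabilizer (L ≃ₐ[F] L) (D.u ^ 2) := hu
  exact (IsGalois.mem_range_algebraMap_iff_fixed (D.u ^ 2)).2 fun g =>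
    (Subgroup.zpowers_le.2 hst) (D.generates g)

/-- The element `u²` of `F`, for `d = 1` or `d = 2`. -/
def uSq (D : DegreeDatum d F L) (hd : d ∣ 2) : F := (D.exists_sq hd).choose

theorem algebraMap_uSq (D : DegreeDatum d F L) (hd : d ∣ 2) :
    algebraMap F L (D.uSq hd) = D.u ^ 2 := (D.exists_sq hd).choose_spec

end DegreeDatum

/-! ## Oriented surfaces with marked points and weighted orbifold points -/

/-- `f : ℂ → ℂ`, injective and continuous near `z`, preserves the orientation at `z`: the image of
every small positively oriented circle around `z` winds once, positively, around `f z`. -/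
def OrientationPreservingAt (f : ℂ → ℂ) (z : ℂ) : Prop :=
  ∀ᶠ r : ℝ in 𝓝[>] 0, ∃ φ : ℝ → ℝ, Continuous φ ∧
    (∀ t : ℝ, f (z + r * Complex.exp (t * Complex.I)) - f z =
      ‖f (z + r * Complex.exp (t * Complex.I)) - f z‖ * Complex.exp (φ t * Complex.I)) ∧
    φ (2 * Real.pi) = φ 0 + 2 * Real.pi

/-- The boundary `∂Σ` of a topological surface. -/
abbrev surfaceBoundary (X : Type*) [TopologicalSpace X] [ChartedSpace (EuclideanHalfSpace 2) X] :
    Set X := (𝓡∂ 2).boundary X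

/-- An orientation of a topological surface, given by an oriented atlas of its interior. -/
structure SurfaceOrientation (X : Type*) [TopologicalSpace X]
    [ChartedSpace (EuclideanHalfSpace 2) X] where
  charts : Set (OpenPartialHomeomorph X ℂ)
  covers : (⋃ e ∈ charts, e.source) = (surfaceBoundary X)ᶜ
  compatible : ∀ e ∈ charts, ∀ e' ∈ charts, ∀ z ∈ (e.symm.trans e').source,
    OrientationPreservingAt (e.symm.trans e') z

/-- An oriented surface with marked points and weighted orbifold points `(Σ, 𝕄, 𝕆, ω)`.
Compactness and connectedness of `Σ` are added where the structure is used. -/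
structure WeightedOrbifoldSurface (X : Type*) [TopologicalSpace X]
    [ChartedSpace (EuclideanHalfSpace 2) X] where
  orientation : SurfaceOrientation X
  marked : Finset X
  marked_nonempty : marked.Nonempty
  marked_meets_boundary : ∀ x ∈ surfaceBoundary X,
    ∃ m ∈ marked, m ∈ connectedComponentIn (surfaceBoundary X) x
  orbifold : Finset X
  orbifold_interior : ∀ q ∈ orbifold, q ∉ surfaceBoundary X
  orbifold_not_marked : ∀ q ∈ orbifold, q ∉ marked
  ω : {q // q ∈ orbifold} → ℕ
  ω_eq : ∀ q, ω q = 1 ∨ ω q = 4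

namespace WeightedOrbifoldSurface

variable {X : Type*} [TopologicalSpace X] [ChartedSpace (EuclideanHalfSpace 2) X]

def IsUnpunctured (S : WeightedOrbifoldSurface X) : Prop :=
  ∀ m ∈ S.marked, m ∈ surfaceBoundary X

def IsOncePuncturedClosed (S : WeightedOrbifoldSurface X) : Prop :=
  surfaceBoundary X = ∅ ∧ S.marked.card = 1

/-- The eight excluded surfaces: the once-punctured closed sphere with fewer than four orbifold
points, the unpunctured disc with one marked and one orbifold point, and the unpunctured discs with
at most three marked points and no orbifold point. -/
def IsExcluded (S : WeightedOrbifoldSurface X) : Prop :=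
  (Nonempty (X ≃ₜ Metric.sphere (0 : EuclideanSpace ℝ (Fin 3)) 1) ∧
      S.IsOncePuncturedClosed ∧ S.orbifold.card < 4) ∨
    (Nonempty (X ≃ₜ Metric.closedBall (0 : EuclideanSpace ℝ (Fin 2)) 1) ∧ S.IsUnpunctured ∧
      ((S.marked.card = 1 ∧ S.orbifold.card = 1) ∨
        (S.marked.card ≤ 3 ∧ S.orbifold.card = 0)))

/-- The standing assumptions on the surface. -/
def IsAdmissible (S : WeightedOrbifoldSurface X) : Prop :=
  (S.IsUnpunctured ∨ S.IsOncePuncturedClosed) ∧ ¬ S.IsExcluded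

end WeightedOrbifoldSurface

/-! ## Triangulations -/

/-- The standard triangle in `ℂ`, with the vertices `0`, `1`, `i` in positive cyclic order. -/
def stdTriangle : Set ℂ := {z | 0 ≤ z.re ∧ 0 ≤ z.im ∧ z.re + z.im ≤ 1}

/-- The vertex number `n` of the standard triangle. -/
def stdVertex : Fin 3 → ℂ := ![0, 1, Complex.I]

/-- The side number `n` of the standard triangle, running from vertex `n` to vertex `n + 1`. -/
def stdSide (n : Fin 3) (t : ℝ) : ℂ := (1 - t) * stdVertex n + t * stdVertex (n + 1)

/-- The gluing of triangles along sides: the side `e` is glued, with reversed direction, to the side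
`opp e`. If `opp e = e`, this folds the side `e` at its midpoint. -/
inductive GlueRel {Tri : Type} (opp : Tri × Fin 3 → Option (Tri × Fin 3)) :
    Tri × ℂ → Tri × ℂ → Prop
  | glue (e e' : Tri × Fin 3) (t : ℝ) (ht : t ∈ Set.Icc (0 : ℝ) 1) (h : opp e = some e') :
      GlueRel opp (e.1, stdSide e.2 t) (e'.1, stdSide e'.2 (1 - t))

/-- A triangulation `τ` of `(Σ, 𝕄, 𝕆)`, given by the triangles into which its arcs cut `Σ`.

`Tri` is the finite set of triangles, each with a positively oriented characteristic map from the
standard triangle to `Σ`; the sides of a triangle are numbered along its positively oriented boundary.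
`opp e = none` says that the side `e` is a boundary segment. `opp e = some e'` with `e' ≠ e` says that
the sides `e` and `e'` are the two sides of one non-pending arc. `opp e = some e` says that the side
`e` runs along a pending arc from its marked point to its orbifold point and back (a triangle with
`m` orbifold points, cut open along its `m` pending arcs, is a triangle with `m` such sides).
`Σ` is the result of these identifications. The vertices are the marked points, the midpoints of the
folded sides are the orbifold points, and the unglued sides form the boundary. -/
structure Triangulation {X : Type*} [TopologicalSpace X] [ChartedSpace (EuclideanHalfSpace 2) X]
    (S : WeightedOrbifoldSurface X) where
  Tri : Type
  [fintypeTri : Fintype Tri]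
  opp : Tri × Fin 3 → Option (Tri × Fin 3)
  opp_symm : ∀ e e', opp e = some e' → opp e' = some e
  char : Tri → ℂ → X
  continuousOn_char : ∀ T, ContinuousOn (char T) stdTriangle
  exists_char_eq : ∀ x, ∃ T, ∃ z ∈ stdTriangle, char T z = x
  char_eq_iff : ∀ T T', ∀ z ∈ stdTriangle, ∀ z' ∈ stdTriangle,
    char T z = char T' z' ↔ Relation.EqvGen (GlueRel opp) (T, z) (T', z')
  orientation_char : ∀ T z, 0 < z.re → 0 < z.im → z.re + z.im < 1 →
    ∀ e ∈ S.orientation.charts, char T z ∈ e.source →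
      OrientationPreservingAt (fun w => e (char T w)) z
  mem_marked_iff : ∀ x, x ∈ S.marked ↔ ∃ T n, char T (stdVertex n) = x
  mem_orbifold_iff : ∀ x, x ∈ S.orbifold ↔
    ∃ e, opp e = some e ∧ char e.1 (stdSide e.2 (1 / 2)) = x
  mem_boundary_iff : ∀ x, x ∈ surfaceBoundary X ↔
    ∃ e, opp e = none ∧ ∃ t ∈ Set.Icc (0 : ℝ) 1, char e.1 (stdSide e.2 t) = x

attribute [instance] Triangulation.fintypeTri

namespace Triangulation

variable {X : Type*} [TopologicalSpace X] [ChartedSpace (EuclideanHalfSpace 2) X]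
  {S : WeightedOrbifoldSurface X} (τ : Triangulation S)

/-- The sides of triangles that are not boundary segments. -/
def ArcSide : Type := {e : τ.Tri × Fin 3 // (τ.opp e).isSome}

/-- Two sides run along the same arc. -/
def sameArc : Setoid τ.ArcSide where
  r e e' := e = e' ∨ τ.opp e.1 = some e'.1
  iseqv :=
    { refl := fun _ => Or.inl rfl
      symm := by
        rintro e e' (h | h)
        · exact Or.inl h.symm
        · exact Or.inr (τ.opp_symm _ _ h)
      trans := by
        rintro e e' e'' (h | h) (h' | h')
        · exact Or.inl (h.trans h')
        · exact Or.inr (h ▸ h')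
        · exact Or.inr (h' ▸ h)
        · have h1 := τ.opp_symm _ _ h
          exact Or.inl (Subtype.ext (Option.some.inj (h1.symm.trans h'))) }

/-- The arcs of `τ`. -/
def Arc : Type := Quotient τ.sameArc

instance : Finite τ.ArcSide := inferInstanceAs (Finite {e : τ.Tri × Fin 3 // (τ.opp e).isSome})

instance : Finite τ.Arc := inferInstanceAs (Finite (Quotient τ.sameArc))

instance : Fintype τ.Arc := Fintype.ofFinite _

/-- The arc along which a side runs. -/
def arc (e : τ.Tri × Fin 3) (h : (τ.opp e).isSome) : τ.Arc := Quotient.mk τ.sameArc ⟨e, h⟩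

/-- The pending arcs are those that connect a marked point with an orbifold point. -/
def IsPending (k : τ.Arc) : Prop := ∃ e h, τ.opp e = some e ∧ τ.arc e h = k

/-- The orbifold point of a pending arc. -/
def orbifoldPoint (k : τ.Arc) (hk : τ.IsPending k) : {q // q ∈ S.orbifold} :=
  ⟨τ.char hk.choose.1 (stdSide hk.choose.2 (1 / 2)),
    (τ.mem_orbifold_iff _).2 ⟨hk.choose, hk.choose_spec.choose_spec.1, rfl⟩⟩

open Classical in
/-- The weight `d(τ,ω)_k`. -/
def weight (k : τ.Arc) : ℕ := if hk : τ.IsPending k then S.ω (τ.orbifoldPoint k hk) else 2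

/-- The integer `δ = lcm {d(τ,ω)_k / 2 | k ∈ τ}`, for `ω ≡ 4`. -/
def delta : ℕ := Finset.univ.lcm fun k => τ.weight k / 2

theorem delta_dvd_two (hω : ∀ q, S.ω q = 4) : τ.delta ∣ 2 := by
  refine Finset.lcm_dvd fun k _ => ?_
  unfold weight
  split_ifs
  · rw [hω]
  · norm_num

/-- The arrows of `Q̄(τ)`: the side number `n + 1` of a triangle succeeds the side number `n` with
respect to the orientation, and both are arcs. -/
def Corner : Type :=
  {e : τ.Tri × Fin 3 // (τ.opp e).isSome ∧ (τ.opp (e.1, e.2 + 1)).isSome}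

instance : Finite τ.Corner := inferInstanceAs
  (Finite {e : τ.Tri × Fin 3 // (τ.opp e).isSome ∧ (τ.opp (e.1, e.2 + 1)).isSome})

instance : Fintype τ.Corner := Fintype.ofFinite _

/-- The quiver `Q̄(τ)`. -/
def quiverBar : FinQuiver where
  V := τ.Arc
  E := τ.Corner
  head c := τ.arc (c.1.1, c.1.2 + 1) c.2.2
  tail c := τ.arc c.1 c.2.1

def PendingArc : Type := {k : τ.Arc // τ.IsPending k}

instance : Finite τ.PendingArc := inferInstanceAs (Finite {k : τ.Arc // τ.IsPending k})

instance : Fintype τ.PendingArc := Fintype.ofFinite _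

/-- The quiver `Q̂(τ)`, obtained from `Q̄(τ)` by adding one loop at each pending arc. -/
def quiverHat : FinQuiver where
  V := τ.Arc
  E := τ.Corner ⊕ τ.PendingArc
  head := Sum.elim τ.quiverBar.head Subtype.val
  tail := Sum.elim τ.quiverBar.tail Subtype.val

/-- The set `𝕊(τ)` of special loops. -/
def specialLoops : Set τ.quiverHat.E := Set.range (Sum.inr : τ.PendingArc → τ.Corner ⊕ τ.PendingArc)

/-- A triangle is interior if all its sides are arcs. -/
def IsInterior (T : τ.Tri) : Prop := ∀ n, (τ.opp (T, n)).isSome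

/-- The arrow of `Q̂(τ)` from the side number `n` to the side number `n + 1` of an interior
triangle. -/
def cornerArrow (T : τ.Tri) (hT : τ.IsInterior T) (n : Fin 3) : τ.quiverHat.E :=
  (Sum.inl ⟨(T, n), hT n, hT (n + 1)⟩ : τ.Corner ⊕ τ.PendingArc)

/-- The set `Z(τ)` of zero-relations: the products of two consecutive arrows in an interior
triangle. -/
def zeroRelations : Set τ.quiverHat.Path :=
  {p | ∃ (T : τ.Tri) (hT : τ.IsInterior T) (n : Fin 3),
    p = FinQuiver.Path.two (τ.cornerArrow T hT (n + 1)) (τ.cornerArrow T hT n) rfl}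

/-- All arrows of `Q̂(τ)` carry the trivial automorphism of `F`. -/
def trivialAut (F : Type*) [Field F] : τ.quiverHat.E → (F ≃ₐ[F] F) := fun _ => AlgEquiv.refl

/-- The ideal `I(τ)` of `F_σ Q̂(τ)`, generated by `Z(τ)` and by the special relations `s² - c e_k`
for the special loops `s` at the pending arcs `k`. -/
def relationIdeal (F : Type*) [Field F] (c : F) :
    TwoSidedIdeal (SemilinearPathAlgebra (τ.trivialAut F)) :=
  TwoSidedIdeal.span
    (SemilinearPathAlgebra.ofPath (τ.trivialAut F) '' τ.zeroRelations ∪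
      Set.range fun k : τ.PendingArc =>
        SemilinearPathAlgebra.ofArrow (τ.trivialAut F) (Sum.inr k : τ.Corner ⊕ τ.PendingArc) ^ 2
          - SemilinearPathAlgebra.scalarAt (Q := τ.quiverHat) (τ.trivialAut F) k.1 c)

end Triangulation

end

/-!
The conditions (Q) and (Z) are local and combinatorial. An arc is a class of at most two sides of
triangles, and it is a single side exactly when the arc is pending. An arrow of `Q̄(τ)` starts at a
unique side and ends at a unique side, so at most two arrows of `Q̄(τ)` start (or end) at an arc, and
at most one if the arc is pending; the special loop then takes the free place
(`encard_head_fiber_le`, `encard_tail_fiber_le`). The same dichotomy gives (Z): of the two places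
after an arrow `a` of a triangle, one is on the other side of the target arc (or is its special
loop), and the other is the next corner of the same triangle, which exists only in an interior
triangle, where its product with `a` is a zero-relation; the places before `a` are dual
(`subsingleton_notMem_mul`, `subsingleton_mul_notMem`).

For the conditions on `q_s = x² - u²`: with trivial twist, `F[x;1]` is an image of the ordinary
polynomial ring, hence commutative, so `q_s` is normal. If there is a special loop, then `δ = 2`, so
`θ(u) = -u ≠ u`, and `u²` is not a square in `F` (`DegreeDatum.uSq_ne_sq`). Therefore `x² - u²` is
irreducible, and the quotient of `F[x;1]` by it is an image of a field
(`isOfSemisimpleType_skewQuadratic`).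
-/

open FinQuiver

/-! ### Quadratics in untwisted skew polynomial rings -/

section UntwistedSkewPolynomials

variable {F K : Type*} [Field F] [Field K] [Algebra F K]

theorem refl_smul (m : Multiplicative ℕ) (a : TwistedField (AlgEquiv.refl : K ≃ₐ[F] K)) :
    m • a = a := by
  change ((1 : K ≃ₐ[F] K) ^ Multiplicative.toAdd m) (show K from a) = a
  rw [one_pow]
  rfl

/-- The canonical map from the polynomial ring to the skew polynomial ring with trivial twist. -/
noncomputable def untwist : Polynomial (TwistedField (AlgEquiv.refl : K ≃ₐ[F] K)) →+*
    SkewPolyRing (AlgEquiv.refl : K ≃ₐ[F] K) :=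
  Polynomial.eval₂RingHom' SkewPolynomial.CRingHom SkewPolynomial.X fun a => by
    rw [SkewPolynomial.CRingHom_eq_C, ← SkewPolynomial.monomial_one_one_eq_X]
    change _ * _ = _ * _
    rw [SkewPolynomial.C_mul_monomial, SkewPolynomial.monomial_mul_C,
      SkewPolynomial.φ_iterate_apply, refl_smul, mul_comm]

theorem untwist_monomial (n : ℕ) (a : TwistedField (AlgEquiv.refl : K ≃ₐ[F] K)) :
    untwist (Polynomial.monomial n a) = SkewPolynomial.monomial n a := by
  change Polynomial.eval₂ _ _ _ = _
  rw [Polynomial.eval₂_monomial, SkewPolynomial.CRingHom_eq_C,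
    SkewPolynomial.C_mul_X_pow_eq_monomial]

theorem untwist_surjective : Function.Surjective (untwist (F := F) (K := K)) := by
  intro r
  induction r using SkewPolynomial.induction with
  | h0 => exact ⟨0, map_zero _⟩
  | ha n a q _ _ hq =>
    obtain ⟨p, rfl⟩ := hq
    exact ⟨Polynomial.monomial n a + p, by rw [map_add, untwist_monomial]⟩

theorem isNormalElement_of_refl (q : SkewPolyRing (AlgEquiv.refl : K ≃ₐ[F] K)) :
    IsNormalElement q := by
  have hcomm (r : SkewPolyRing (AlgEquiv.refl : K ≃ₐ[F] K)) : r * q = q * r := by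
    obtain ⟨r, rfl⟩ := untwist_surjective r
    obtain ⟨q, rfl⟩ := untwist_surjective q
    rw [← map_mul, ← map_mul, mul_comm]
  simp only [IsNormalElement, hcomm]

theorem untwist_X_sq_sub_C (c : TwistedField (AlgEquiv.refl : K ≃ₐ[F] K)) :
    untwist (Polynomial.X ^ 2 - Polynomial.C c) =
      skewQuadratic (AlgEquiv.refl : K ≃ₐ[F] K) 0 (-c : TwistedField _) := by
  rw [map_sub, ← Polynomial.monomial_zero_left, Polynomial.X_pow_eq_monomial, untwist_monomial,
    untwist_monomial]
  change _ = SkewPolynomial.monomial 2 1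
    - SkewPolynomial.monomial 1 (0 : TwistedField (AlgEquiv.refl : K ≃ₐ[F] K))
    + SkewPolynomial.monomial 0 (-c)
  rw [SkewPolynomial.monomial_neg, SkewPolynomial.monomial_zero_right, sub_zero, sub_eq_add_neg]

/-- If `c` is not a square, then `K[x]/(x² - c)` is a field. -/
theorem isOfSemisimpleType_skewQuadratic (c : K) (hc : ∀ a : K, a ^ 2 ≠ c) :
    IsOfSemisimpleType (skewQuadratic (AlgEquiv.refl : K ≃ₐ[F] K) 0 (-c)) := by
  let k := TwistedField (AlgEquiv.refl : K ≃ₐ[F] K)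
  let p : Polynomial k := Polynomial.X ^ 2 - Polynomial.C (show k from c)
  let q := skewQuadratic (AlgEquiv.refl : K ≃ₐ[F] K) 0 (-c)
  have hp : Irreducible p := X_pow_sub_C_irreducible_of_prime Nat.prime_two hc
  have : Fact (Irreducible p) := ⟨hp⟩
  have : IsSemisimpleRing (Polynomial k ⧸ Ideal.span {p}) :=
    inferInstanceAs (IsSemisimpleRing (AdjoinRoot p))
  let π := (TwoSidedIdeal.span {q}).ringCon.mk'
  let f := π.comp (untwist (F := F) (K := K))
  have hf : Function.Surjective f :=
    ((TwoSidedIdeal.span {q}).ringCon.mk'_surjective).comp untwist_surjective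
  have hq : π q = 0 := by
    rw [← TwoSidedIdeal.mem_ker, TwoSidedIdeal.ker_ringCon_mk']
    exact TwoSidedIdeal.subset_span rfl
  have hker : ∀ a ∈ Ideal.span {p}, f a = 0 := by
    intro a ha
    obtain ⟨b, rfl⟩ := Ideal.mem_span_singleton'.1 ha
    rw [map_mul, show f p = π q from congrArg π (untwist_X_sq_sub_C _), hq, mul_zero]
  exact RingHom.isSemisimpleRing_of_surjective
    (Ideal.Quotient.lift (Ideal.span {p}) f hker)
    (Ideal.Quotient.lift_surjective_of_surjective _ hker hf)

theorem coeff_zero_skewQuadratic (σ : K ≃ₐ[F] K) (β γ : K) :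
    SkewPolynomial.coeff (skewQuadratic σ β γ) 0 = (show TwistedField σ from γ) := by
  rw [skewQuadratic, SkewPolynomial.coeff_add, SkewPolynomial.coeff_sub,
    SkewPolynomial.coeff_monomial, SkewPolynomial.coeff_monomial, SkewPolynomial.coeff_monomial,
    if_neg two_ne_zero, if_neg one_ne_zero, if_pos rfl, sub_zero, zero_add]

end UntwistedSkewPolynomials

/-! ### The element `u²` -/

namespace DegreeDatum

variable {d : ℕ} {F L : Type*} [Field F] [Field L] [Algebra F L]

theorem uSq_ne_zero (D : DegreeDatum d F L) (hd : d ∣ 2) : D.uSq hd ≠ 0 := by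
  intro h
  have h2 := D.algebraMap_uSq hd
  rw [h, map_zero] at h2
  exact pow_ne_zero 2 D.u_ne_zero h2.symm

/-- In degree two, a square root of `u²` in `F` would be `±u`, which `θ` does not fix. -/
theorem uSq_ne_sq (D : DegreeDatum d F L) (hd : d ∣ 2) (hd1 : d ≠ 1) (a : F) :
    a ^ 2 ≠ D.uSq hd := by
  intro h
  have h2 : D.u ^ 2 = algebraMap F L a ^ 2 := by rw [← D.algebraMap_uSq hd, ← h, map_pow]
  have hfix : D.θ D.u = D.u := by
    rcases sq_eq_sq_iff_eq_or_eq_neg.1 h2 with h | h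
    · rw [h, AlgEquiv.commutes]
    · rw [h, map_neg, AlgEquiv.commutes]
  have hζ : D.ζ = 1 := by
    have h3 : algebraMap F L D.ζ * D.u = 1 * D.u := by rw [← D.θ_u, hfix, one_mul]
    exact (algebraMap F L).injective ((mul_right_cancel₀ D.u_ne_zero h3).trans (map_one _).symm)
  exact hd1 (D.isPrimitiveRoot.unique (hζ ▸ IsPrimitiveRoot.one))

end DegreeDatum

/-! ### Arrows at an arc -/

theorem Set.encard_le_two_of_subset_union {α : Type*} {A B C : Set α} (h : A ⊆ B ∪ C)
    (hB : B.Subsingleton) (hC : C.Subsingleton) : A.encard ≤ 2 :=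
  calc A.encard ≤ (B ∪ C).encard := Set.encard_le_encard h
    _ ≤ B.encard + C.encard := Set.encard_union_le B C
    _ ≤ 1 + 1 := add_le_add (Set.encard_le_one_iff_subsingleton.2 hB)
      (Set.encard_le_one_iff_subsingleton.2 hC)
    _ = 2 := one_add_one_eq_two

namespace Triangulation

variable {X : Type*} [TopologicalSpace X] [ChartedSpace (EuclideanHalfSpace 2) X]
  {S : WeightedOrbifoldSurface X} (τ : Triangulation S)

theorem arc_eq_iff {e e' : τ.Tri × Fin 3} (h : (τ.opp e).isSome) (h' : (τ.opp e').isSome) :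
    τ.arc e h = τ.arc e' h' ↔ e = e' ∨ τ.opp e = some e' := by
  refine Quotient.eq.trans (or_congr_left ?_)
  exact Subtype.ext_iff

theorem exists_arc_eq (k : τ.Arc) : ∃ e h, τ.arc e h = k := by
  obtain ⟨⟨e, h⟩, rfl⟩ := Quotient.exists_rep k
  exact ⟨e, h, rfl⟩

theorem isPending_arc_iff {e : τ.Tri × Fin 3} (h : (τ.opp e).isSome) :
    τ.IsPending (τ.arc e h) ↔ τ.opp e = some e := by
  refine ⟨?_, fun he => ⟨e, h, he, rfl⟩⟩
  rintro ⟨e', h', he', heq⟩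
  rcases (τ.arc_eq_iff h' h).1 heq with rfl | h1
  · exact he'
  · obtain rfl : e' = e := Option.some.inj (he'.symm.trans h1)
    exact he'

/-- At the arc along the side `e`, apart from the arrows ending at `e` itself, there is only one
place: the opposite side if the arc is not pending, the special loop if it is. -/
theorem head_eq_arc {e : τ.Tri × Fin 3} (h : (τ.opp e).isSome) {b : τ.quiverHat.E}
    (hb : τ.quiverHat.head b = τ.arc e h) :
    (∃ c : τ.Corner, b = Sum.inl c ∧ (c.1.1, c.1.2 + 1) = e) ∨
      ((∃ c : τ.Corner, b = Sum.inl c ∧ τ.opp e = some (c.1.1, c.1.2 + 1) ∧ τ.opp e ≠ some e) ∨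
        ∃ k : τ.PendingArc, b = Sum.inr k ∧ k.1 = τ.arc e h ∧ τ.opp e = some e) := by
  rcases b with c | k
  · rcases (τ.arc_eq_iff h c.2.2).1 (show _ = τ.arc _ c.2.2 from hb.symm) with h1 | h1
    · exact .inl ⟨c, rfl, h1.symm⟩
    · by_cases he : τ.opp e = some e
      · exact .inl ⟨c, rfl, Option.some.inj (h1.symm.trans he)⟩
      · exact .inr (.inl ⟨c, rfl, h1, he⟩)
  · have hk : k.1 = τ.arc e h := hb
    exact .inr (.inr ⟨k, rfl, hk, (τ.isPending_arc_iff h).1 (hk ▸ k.2)⟩)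

/-- The analogue of `head_eq_arc` for the arrows starting at an arc. -/
theorem tail_eq_arc {e : τ.Tri × Fin 3} (h : (τ.opp e).isSome) {b : τ.quiverHat.E}
    (hb : τ.quiverHat.tail b = τ.arc e h) :
    (∃ c : τ.Corner, b = Sum.inl c ∧ c.1 = e) ∨
      ((∃ c : τ.Corner, b = Sum.inl c ∧ τ.opp e = some c.1 ∧ τ.opp e ≠ some e) ∨
        ∃ k : τ.PendingArc, b = Sum.inr k ∧ k.1 = τ.arc e h ∧ τ.opp e = some e) := by
  rcases b with c | k
  · rcases (τ.arc_eq_iff h c.2.1).1 (show _ = τ.arc _ c.2.1 from hb.symm) with h1 | h1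
    · exact .inl ⟨c, rfl, h1.symm⟩
    · by_cases he : τ.opp e = some e
      · exact .inl ⟨c, rfl, Option.some.inj (h1.symm.trans he)⟩
      · exact .inr (.inl ⟨c, rfl, h1, he⟩)
  · have hk : k.1 = τ.arc e h := hb
    exact .inr (.inr ⟨k, rfl, hk, (τ.isPending_arc_iff h).1 (hk ▸ k.2)⟩)

theorem corner_eq_of_end_eq {c c' : τ.Corner} (h : (c.1.1, c.1.2 + 1) = (c'.1.1, c'.1.2 + 1)) :
    c = c' :=
  Subtype.ext (Prod.ext (Prod.mk.inj h).1 (add_right_cancel (Prod.mk.inj h).2))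

theorem subsingleton_end (e : τ.Tri × Fin 3) :
    {b : τ.quiverHat.E | ∃ c : τ.Corner, b = Sum.inl c ∧ (c.1.1, c.1.2 + 1) = e}.Subsingleton := by
  rintro _ ⟨c, rfl, h⟩ _ ⟨c', rfl, h'⟩
  rw [τ.corner_eq_of_end_eq (h.trans h'.symm)]

theorem subsingleton_start (e : τ.Tri × Fin 3) :
    {b : τ.quiverHat.E | ∃ c : τ.Corner, b = Sum.inl c ∧ c.1 = e}.Subsingleton := by
  rintro _ ⟨c, rfl, h⟩ _ ⟨c', rfl, h'⟩
  rw [Subtype.ext (h.trans h'.symm)]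

theorem subsingleton_opposite_end {e : τ.Tri × Fin 3} (h : (τ.opp e).isSome) :
    {b : τ.quiverHat.E |
      (∃ c : τ.Corner, b = Sum.inl c ∧ τ.opp e = some (c.1.1, c.1.2 + 1) ∧ τ.opp e ≠ some e) ∨
        ∃ k : τ.PendingArc, b = Sum.inr k ∧ k.1 = τ.arc e h ∧ τ.opp e = some e}.Subsingleton := by
  rintro _ (⟨c, rfl, h1, h2⟩ | ⟨k, rfl, h1, h2⟩) _ (⟨c', rfl, h1', h2'⟩ | ⟨k', rfl, h1', h2'⟩)
  · rw [τ.corner_eq_of_end_eq (Option.some.inj (h1.symm.trans h1'))]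
  · exact absurd h2' h2
  · exact absurd h2 h2'
  · rw [Subtype.ext (h1.trans h1'.symm)]

theorem subsingleton_opposite_start {e : τ.Tri × Fin 3} (h : (τ.opp e).isSome) :
    {b : τ.quiverHat.E |
      (∃ c : τ.Corner, b = Sum.inl c ∧ τ.opp e = some c.1 ∧ τ.opp e ≠ some e) ∨
        ∃ k : τ.PendingArc, b = Sum.inr k ∧ k.1 = τ.arc e h ∧ τ.opp e = some e}.Subsingleton := by
  rintro _ (⟨c, rfl, h1, h2⟩ | ⟨k, rfl, h1, h2⟩) _ (⟨c', rfl, h1', h2'⟩ | ⟨k', rfl, h1', h2'⟩)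
  · rw [Subtype.ext (Option.some.inj (h1.symm.trans h1'))]
  · exact absurd h2' h2
  · exact absurd h2 h2'
  · rw [Subtype.ext (h1.trans h1'.symm)]

theorem encard_head_fiber_le (k : τ.Arc) : {b | τ.quiverHat.head b = k}.encard ≤ 2 := by
  obtain ⟨e, h, rfl⟩ := τ.exists_arc_eq k
  exact Set.encard_le_two_of_subset_union (fun _ hb => τ.head_eq_arc h hb)
    (τ.subsingleton_end e) (τ.subsingleton_opposite_end h)

theorem encard_tail_fiber_le (k : τ.Arc) : {b | τ.quiverHat.tail b = k}.encard ≤ 2 := by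
  obtain ⟨e, h, rfl⟩ := τ.exists_arc_eq k
  exact Set.encard_le_two_of_subset_union (fun _ hb => τ.tail_eq_arc h hb)
    (τ.subsingleton_start e) (τ.subsingleton_opposite_start h)

/-! ### Zero-relations -/

theorem isInterior_of_isSome {T : τ.Tri} (n : Fin 3) (h0 : (τ.opp (T, n)).isSome)
    (h1 : (τ.opp (T, n + 1)).isSome) (h2 : (τ.opp (T, n + 1 + 1)).isSome) : τ.IsInterior T := by
  intro m
  have hm : m = n ∨ m = n + 1 ∨ m = n + 1 + 1 := by
    clear h0 h1 h2; revert m n; decide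
  rcases hm with rfl | rfl | rfl <;> assumption

/-- Two consecutive corners of one triangle use all three of its sides, so the triangle is
interior and their product is a zero-relation. -/
theorem two_mem_zeroRelations {c c' : τ.Corner} (hc : c'.1 = (c.1.1, c.1.2 + 1))
    (h : τ.quiverHat.tail (Sum.inl c' : τ.Corner ⊕ τ.PendingArc) =
      τ.quiverHat.head (Sum.inl c : τ.Corner ⊕ τ.PendingArc)) :
    Path.two (Q := τ.quiverHat) (Sum.inl c' : τ.Corner ⊕ τ.PendingArc)
      (Sum.inl c : τ.Corner ⊕ τ.PendingArc) h ∈ τ.zeroRelations := by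
  obtain ⟨⟨T, n⟩, h0, h1⟩ := c
  obtain ⟨e', h0', h1'⟩ := c'
  obtain rfl : e' = (T, n + 1) := hc
  exact ⟨T, τ.isInterior_of_isSome n h0 h1 h1', n, rfl⟩

theorem subsingleton_notMem_mul (a : τ.quiverHat.E) (ha : a ∉ τ.specialLoops) :
    {b | ∃ h : τ.quiverHat.tail b = τ.quiverHat.head a,
      Path.two b a h ∉ τ.zeroRelations}.Subsingleton := by
  rcases a with c | k
  · refine (τ.subsingleton_opposite_start c.2.2).anti ?_
    rintro b ⟨h, hb⟩
    refine (τ.tail_eq_arc c.2.2 h).resolve_left ?_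
    rintro ⟨c', rfl, hc⟩
    exact hb (τ.two_mem_zeroRelations hc h)
  · exact absurd ⟨k, rfl⟩ ha

theorem subsingleton_mul_notMem (a : τ.quiverHat.E) (ha : a ∉ τ.specialLoops) :
    {b | ∃ h : τ.quiverHat.tail a = τ.quiverHat.head b,
      Path.two a b h ∉ τ.zeroRelations}.Subsingleton := by
  rcases a with c | k
  · refine (τ.subsingleton_opposite_end c.2.1).anti ?_
    rintro b ⟨h, hb⟩
    refine (τ.head_eq_arc c.2.1 h.symm).resolve_left ?_
    rintro ⟨c', rfl, hc⟩
    exact hb (τ.two_mem_zeroRelations hc.symm h)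
  · exact absurd ⟨k, rfl⟩ ha

theorem exists_word_eq_of_mem_zeroRelations {p : τ.quiverHat.Path} (hp : p ∈ τ.zeroRelations) :
    ∃ c c' : τ.Corner,
      p.word = [(Sum.inl c' : τ.Corner ⊕ τ.PendingArc), (Sum.inl c : τ.Corner ⊕ τ.PendingArc)] := by
  obtain ⟨T, hT, n, rfl⟩ := hp
  exact ⟨_, _, rfl⟩

theorem inl_notMem_specialLoops (c : τ.Corner) :
    (Sum.inl c : τ.Corner ⊕ τ.PendingArc) ∉ τ.specialLoops := by
  rintro ⟨k, hk⟩
  cases hk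

/-! ### The clannish presentation -/

theorem delta_ne_one (hω : ∀ q, S.ω q = 4) (k : τ.PendingArc) : τ.delta ≠ 1 := by
  intro h
  have h1 : τ.weight k.1 / 2 ∣ τ.delta := Finset.dvd_lcm (Finset.mem_univ k.1)
  rw [weight, dif_pos k.2, hω, h] at h1
  norm_num at h1

theorem relationIdeal_eq_span (F : Type*) [Field F] (c : F) :
    τ.relationIdeal F c = TwoSidedIdeal.span
      (SemilinearPathAlgebra.ofPath (τ.trivialAut F) '' τ.zeroRelations ∪
        Set.range fun s : τ.specialLoops =>
          SemilinearPathAlgebra.ofArrow (τ.trivialAut F) s *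
              SemilinearPathAlgebra.ofArrow (τ.trivialAut F) s
            - SemilinearPathAlgebra.scalarAt (τ.trivialAut F) (τ.quiverHat.head s) 0 *
              SemilinearPathAlgebra.ofArrow (τ.trivialAut F) s
            + SemilinearPathAlgebra.scalarAt (τ.trivialAut F) (τ.quiverHat.head s) (-c)) := by
  have hrel (k : τ.PendingArc) :
      SemilinearPathAlgebra.ofArrow (τ.trivialAut F) (Sum.inr k : τ.Corner ⊕ τ.PendingArc) ^ 2
          - SemilinearPathAlgebra.scalarAt (Q := τ.quiverHat) (τ.trivialAut F) k.1 c =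
        SemilinearPathAlgebra.ofArrow (τ.trivialAut F) (Sum.inr k : τ.Corner ⊕ τ.PendingArc) *
            SemilinearPathAlgebra.ofArrow (τ.trivialAut F) (Sum.inr k : τ.Corner ⊕ τ.PendingArc)
          - SemilinearPathAlgebra.scalarAt (Q := τ.quiverHat) (τ.trivialAut F) k.1 0 *
            SemilinearPathAlgebra.ofArrow (τ.trivialAut F) (Sum.inr k : τ.Corner ⊕ τ.PendingArc)
          + SemilinearPathAlgebra.scalarAt (Q := τ.quiverHat) (τ.trivialAut F) k.1 (-c) := by
    have hneg : SemilinearPathAlgebra.scalarAt (Q := τ.quiverHat) (τ.trivialAut F) k.1 (-c) =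
        -SemilinearPathAlgebra.scalarAt (Q := τ.quiverHat) (τ.trivialAut F) k.1 c :=
      Finsupp.single_neg _ _
    have hzero : SemilinearPathAlgebra.scalarAt (Q := τ.quiverHat) (τ.trivialAut F) k.1 0 = 0 :=
      SemilinearPathAlgebra.term_zero _ _
    rw [hneg, hzero, zero_mul, sub_zero, sq, sub_eq_add_neg]
  refine congrArg TwoSidedIdeal.span (congrArg (Union.union _) (Set.ext fun x => ⟨?_, ?_⟩))
  · rintro ⟨k, rfl⟩
    exact ⟨⟨_, k, rfl⟩, (hrel k).symm⟩
  · rintro ⟨⟨_, k, rfl⟩, rfl⟩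
    exact ⟨k, hrel k⟩

/-- The presentation of `F_σ Q̂(τ) / I(τ)` with `β_s = 0` and `γ_s = -c` for all special loops. -/
def clannishPresentation (F : Type*) [Field F] (c : F) :
    SemilinearClannishPresentation (τ.trivialAut F) (τ.relationIdeal F c) where
  finiteDimensional := inferInstance
  isGalois := inferInstance
  isCyclic := inferInstance
  special := τ.specialLoops
  head_eq_tail := by
    rintro _ ⟨k, rfl⟩
    rfl
  encard_head_le := τ.encard_head_fiber_le
  encard_tail_le := τ.encard_tail_fiber_le
  Z := τ.zeroRelations
  two_le_length p hp := by
    obtain ⟨c, c', h⟩ := τ.exists_word_eq_of_mem_zeroRelations hp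
    rw [h]
    exact le_rfl
  subsingleton_left := τ.subsingleton_notMem_mul
  subsingleton_right := τ.subsingleton_mul_notMem
  not_starts p hp s hs h := by
    obtain ⟨c, c', hw⟩ := τ.exists_word_eq_of_mem_zeroRelations hp
    replace h : some (Sum.inl c : τ.Corner ⊕ τ.PendingArc) = some s := by rw [hw] at h; exact h
    exact τ.inl_notMem_specialLoops c (Option.some.inj h ▸ hs)
  not_ends p hp s hs h := by
    obtain ⟨c, c', hw⟩ := τ.exists_word_eq_of_mem_zeroRelations hp
    rw [hw] at h
    exact τ.inl_notMem_specialLoops c' (Option.some.inj h ▸ hs)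
  not_square p hp s hs h := by
    obtain ⟨c, c', hw⟩ := τ.exists_word_eq_of_mem_zeroRelations hp
    rw [hw] at h
    have h1 := h.eq_of_length rfl
    exact τ.inl_notMem_specialLoops c' ((List.cons.inj h1).1 ▸ hs)
  β _ := 0
  γ _ := -c
  ideal_eq := τ.relationIdeal_eq_span F c

end Triangulation

theorem mainTheorem7 {X : Type*} [TopologicalSpace X] [T2Space X] [CompactSpace X] [ConnectedSpace X]
    [ChartedSpace (EuclideanHalfSpace 2) X]
    (S : WeightedOrbifoldSurface X) (hS : S.IsAdmissible) (hω : ∀ q, S.ω q = 4)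
    (τ : Triangulation S)
    {F L : Type*} [Field F] [Field L] [Algebra F L] (D : DegreeDatum τ.delta F L) :
    ∃ P : SemilinearClannishPresentation (τ.trivialAut F)
        (τ.relationIdeal F (D.uSq (τ.delta_dvd_two hω))),
      P.special = τ.specialLoops ∧ P.Z = τ.zeroRelations ∧
      (∀ s, P.β s = 0 ∧ P.γ s = -D.uSq (τ.delta_dvd_two hω)) ∧
      P.IsNormallyBound ∧ P.IsNonSingular ∧ P.IsSemisimpleType := by
  refine ⟨τ.clannishPresentation F _, rfl, rfl, fun _ => ⟨rfl, rfl⟩, fun s => ?_, fun s => ?_,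
    fun s => ?_⟩
  · exact isNormalElement_of_refl (F := F) (K := F) _
  · have h := coeff_zero_skewQuadratic (τ.trivialAut F s) 0 (-D.uSq (τ.delta_dvd_two hω))
    exact fun h0 => neg_ne_zero.2 (D.uSq_ne_zero (τ.delta_dvd_two hω)) (h.symm.trans h0)
  · obtain ⟨_, k, rfl⟩ := s
    exact isOfSemisimpleType_skewQuadratic (F := F) (K := F) _
      (D.uSq_ne_sq (τ.delta_dvd_two hω) (τ.delta_ne_one hω k))
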